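/- Let $\phi$ be Euler's totient function and let $\Lambda$ be the von Mangoldt function, i.e. $\Lambda(n)=\log p$ if $n=p^k$ with $p$ prime and $k\ge 1$, and $\Lambda(n)=0$ otherwise. For a positive integer $n$ put $$\Lambda_1(n)=\frac{\phi(n)}{n}\,\Lambda(n).$$ Then, as the real variable $x$ tends to infinity, $$\lim_{x\to\infty}\frac1x\sum_{1\le n\le x}\Lambda_1(n)=1 .$$ Moreover, this statement is equivalent to the prime number theorem $$\lim_{x\to\infty}\frac{\pi(x)}{x/\log x}=1,$$ where $\pi(x)$ is the number of primes $p\le x$. -/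

import Mathlib

/-- The modified von Mangoldt function `Λ₁(n) = (φ(n) / n) Λ(n)`, for positive integers `n`.
(At `n = 0` it takes the irrelevant value `0`.) -/
noncomputable def modifiedLambda (n : ℕ) : ℝ :=
  (Nat.totient n : ℝ) / (n : ℝ) * ArithmeticFunction.vonMangoldt n

/-- The mean value of `Λ₁` is one: `(1 / x) ∑_{1 ≤ n ≤ x} Λ₁(n) → 1` as the real variable `x`
tends to infinity. -/
def ModifiedLambdaMeanValueOne : Prop :=
  Filter.Tendsto (fun x : ℝ => 1 / x * ∑ n ∈ Finset.Icc 1 ⌊x⌋₊, modifiedLambda n)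
    Filter.atTop (nhds 1)

/-- The prime number theorem: `π(x) / (x / log x) → 1` as the real variable `x` tends to infinity,
where `π(x)` is the number of primes `p ≤ x`. -/
def PrimeNumberTheorem : Prop :=
  Filter.Tendsto (fun x : ℝ => (Nat.primeCounting ⌊x⌋₊ : ℝ) / (x / Real.log x))
    Filter.atTop (nhds 1)

/-!
Both averages in question are compared with Chebyshev's function `ψ x = ∑ n ≤ x, Λ n`.

The sum of `Λ n - Λ₁ n` over `n ≤ x` is `o(x)`: a prime `p` contributes `log p / p`, which tends
to `0`, and the proper prime powers contribute at most `ψ x - θ x = O(√x)`. Hence the mean value of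
`Λ₁` is one if and only if `ψ x / x → 1` (`modifiedLambdaMeanValueOne_iff_tendsto_psi_div`). By the
same bound on `ψ - θ`, and because `π x - θ x / log x = O(x / log x ^ 2)`, the prime number theorem
is equivalent to the same limit (`primeNumberTheorem_iff_tendsto_theta_div`). The equivalence is
thus elementary, and does not use that either side holds.

It remains to prove `ψ x / x → 1` (`tendsto_psi_div_self`). Put `B u = exp (-u) * ψ (exp u)`, which
is bounded by Chebyshev's estimate. As `ζ` does not vanish on `re s = 1`, the Laplace transform of
`B - 1` extends continuously to the closed half-plane `0 ≤ re z`. By Parseval's identity the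
averages of `B - 1` against translates of a kernel `𝓕 k`, with `k` continuous of compact support,
are Fourier transforms of continuous functions of compact support, so that they tend to `0` by the
Riemann–Lebesgue lemma (`tendsto_integral_mul_fourier_of_laplace`). For the tent function `k`, the
kernel is the nonnegative Fejér kernel, at any scale. Since `exp u * B u` is monotone, `B` cannot
change much over short windows, and the convergence of its averages forces `B` to converge to `1`
(`tendsto_one_of_laplace`).
-/

/-! ### Reduction to Chebyshev's functions -/

open ArithmeticFunction in
theorem vonMangoldt_sub_modifiedLambda_nonneg (n : ℕ) :
    0 ≤ vonMangoldt n - modifiedLambda n := by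
  have h : (Nat.totient n : ℝ) / n ≤ 1 :=
    div_le_one_of_le₀ (by exact_mod_cast Nat.totient_le n) (Nat.cast_nonneg n)
  have h2 := mul_le_mul_of_nonneg_right h (vonMangoldt_nonneg (n := n))
  unfold modifiedLambda
  linarith

open ArithmeticFunction in
theorem modifiedLambda_nonneg (n : ℕ) : 0 ≤ modifiedLambda n :=
  mul_nonneg (by positivity) vonMangoldt_nonneg

open ArithmeticFunction in
/-- At a prime `p` one has `Λ p - Λ₁ p = log p / p`; at the remaining prime powers the crude bound
`Λ n - Λ₁ n ≤ Λ n` is enough, since these contribute only `O(√x)` to `ψ x`. -/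
theorem vonMangoldt_sub_modifiedLambda_le (n : ℕ) :
    vonMangoldt n - modifiedLambda n ≤
      Real.log n / n + if ¬ n.Prime then vonMangoldt n else 0 := by
  by_cases hn : n.Prime
  · have h0 : (n : ℝ) ≠ 0 := by exact_mod_cast hn.ne_zero
    simp only [hn, not_true_eq_false, if_false, add_zero, modifiedLambda,
      vonMangoldt_apply_prime hn, Nat.totient_prime hn, Nat.cast_sub hn.one_le, Nat.cast_one]
    apply le_of_eq
    field_simp
    ring
  · have := modifiedLambda_nonneg n
    have h2 : 0 ≤ Real.log n / n := div_nonneg (Real.log_natCast_nonneg n) (Nat.cast_nonneg n)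
    simp only [hn, not_false_eq_true, if_true]
    linarith

open Filter Topology Asymptotics Chebyshev in
theorem tendsto_psi_sub_theta_div : Tendsto (fun x ↦ (psi x - theta x) / x) atTop (𝓝 0) := by
  have h : (psi - theta) =o[atTop] (fun x : ℝ ↦ x) := by
    refine isBigO_psi_sub_theta_sqrt.trans_isLittleO ?_
    refine isLittleO_of_tendsto' ?_ ?_
    · filter_upwards [eventually_gt_atTop 0] with x hx h0
      exact absurd h0 hx.ne'
    · simpa only [Real.sqrt_div_self] using! Real.tendsto_sqrt_atTop.inv_tendsto_atTop
  simpa using h.tendsto_div_nhds_zero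

open Filter Topology Finset in
theorem tendsto_sum_log_div_self_div :
    Tendsto (fun x : ℝ ↦ (∑ n ∈ Icc 1 ⌊x⌋₊, Real.log n / n) / x) atTop (𝓝 0) := by
  have hlog : Tendsto (fun n : ℕ ↦ Real.log n / n) atTop (𝓝 0) :=
    (Real.isLittleO_log_id_atTop.tendsto_div_nhds_zero).comp tendsto_natCast_atTop_atTop
  have h1 : Tendsto (fun n : ℕ ↦ (n : ℝ)⁻¹ * ∑ i ∈ range n,
      Real.log (i + 1 : ℕ) / (i + 1 : ℕ)) atTop (𝓝 0) :=
    (hlog.comp (tendsto_add_atTop_nat 1)).cesaro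
  have h2 := h1.comp (tendsto_nat_floor_atTop (α := ℝ))
  refine squeeze_zero' ?_ ?_ h2
  · filter_upwards [eventually_ge_atTop 0] with x hx
    exact div_nonneg (sum_nonneg fun n _ ↦ div_nonneg (Real.log_natCast_nonneg n)
      (Nat.cast_nonneg n)) hx
  · filter_upwards [eventually_ge_atTop 1] with x hx
    have hpos : (0 : ℝ) < ⌊x⌋₊ := by exact_mod_cast Nat.floor_pos.2 hx
    have e : ∑ i ∈ range ⌊x⌋₊, Real.log (i + 1 : ℕ) / (i + 1 : ℕ) =
        ∑ n ∈ Icc 1 ⌊x⌋₊, Real.log n / n := by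
      rw [range_eq_Ico, sum_Ico_add' (fun n : ℕ ↦ Real.log n / n) 0 _ 1]
      rfl
    rw [Function.comp_apply, div_eq_inv_mul, e]
    gcongr
    exact Nat.floor_le (by linarith)

open Filter Topology Finset Chebyshev ArithmeticFunction in
theorem tendsto_sum_vonMangoldt_sub_modifiedLambda_div :
    Tendsto (fun x : ℝ ↦ psi x / x - 1 / x * ∑ n ∈ Icc 1 ⌊x⌋₊, modifiedLambda n)
      atTop (𝓝 0) := by
  have h := tendsto_sum_log_div_self_div.add tendsto_psi_sub_theta_div
  rw [add_zero] at h
  have e (x : ℝ) : psi x / x - 1 / x * ∑ n ∈ Icc 1 ⌊x⌋₊, modifiedLambda n =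
      (∑ n ∈ Icc 1 ⌊x⌋₊, (vonMangoldt n - modifiedLambda n)) / x := by
    rw [sum_sub_distrib, psi, ← Icc_add_one_left_eq_Ioc, zero_add]
    ring
  simp only [e]
  refine squeeze_zero' ?_ ?_ h
  · filter_upwards [eventually_ge_atTop 0] with x hx
    exact div_nonneg (sum_nonneg fun n _ ↦ vonMangoldt_sub_modifiedLambda_nonneg n) hx
  · filter_upwards [eventually_ge_atTop 0] with x hx
    rw [← add_div, psi_sub_theta_eq_sum_not_prime, sum_filter, ← Icc_add_one_left_eq_Ioc, zero_add]
    rw [← sum_add_distrib]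
    gcongr
    exact vonMangoldt_sub_modifiedLambda_le _

open Filter Topology Chebyshev in
theorem modifiedLambdaMeanValueOne_iff_tendsto_psi_div :
    ModifiedLambdaMeanValueOne ↔ Tendsto (fun x ↦ psi x / x) atTop (𝓝 1) := by
  have h := tendsto_sum_vonMangoldt_sub_modifiedLambda_div
  constructor
  · intro h1
    simpa using h.add h1
  · intro h1
    simpa [ModifiedLambdaMeanValueOne] using h1.sub h

open Filter Topology Chebyshev in
theorem tendsto_theta_div_iff_tendsto_psi_div :
    Tendsto (fun x ↦ theta x / x) atTop (𝓝 1) ↔ Tendsto (fun x ↦ psi x / x) atTop (𝓝 1) := by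
  have h := tendsto_psi_sub_theta_div
  constructor
  · intro h1
    simpa [sub_div] using h.add h1
  · intro h1
    simpa [sub_div] using h1.sub h

open Filter Topology Chebyshev in
theorem primeNumberTheorem_iff_tendsto_theta_div :
    PrimeNumberTheorem ↔ Tendsto (fun x ↦ theta x / x) atTop (𝓝 1) := by
  have h : Tendsto (fun x : ℝ ↦ (Nat.primeCounting ⌊x⌋₊ : ℝ) / (x / Real.log x) - theta x / x)
      atTop (𝓝 0) := by
    have h1 : (fun x : ℝ ↦ x / Real.log x ^ 2) =o[atTop] (fun x : ℝ ↦ x / Real.log x) := by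
      refine Asymptotics.isLittleO_of_tendsto' ?_ ?_
      · filter_upwards [eventually_gt_atTop 1] with x hx h0
        have := Real.log_pos hx
        exact absurd h0 (by positivity)
      · refine Tendsto.congr' ?_ Real.tendsto_log_atTop.inv_tendsto_atTop
        filter_upwards [eventually_gt_atTop 1] with x hx
        have := Real.log_pos hx
        simp only [Pi.inv_apply]
        field_simp
    refine ((primeCounting_sub_theta_div_log_isBigO.trans_isLittleO
      h1).tendsto_div_nhds_zero).congr' ?_
    filter_upwards [eventually_gt_atTop 1] with x hx
    have := Real.log_pos hx
    field_simp
  constructor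
  · intro h1
    simpa using h1.sub h
  · intro h1
    simpa [PrimeNumberTheorem] using h.add h1

/-! ### Averages against Fourier transforms -/

open MeasureTheory Filter Topology Set FourierTransform in
/-- If the Laplace transform of a bounded function `b` extends continuously to the closed right
half-plane, then the averages of `b` against the translates of an integrable kernel `𝓕 k`, with `k`
continuous of compact support, tend to `0`. -/
theorem tendsto_integral_mul_fourier_of_laplace {b : ℝ → ℝ} {C : ℝ} {G : ℂ → ℂ}
    (hb : Measurable b) (hbC : ∀ u, |b u| ≤ C)
    (hG : ContinuousOn G {z | 0 ≤ z.re})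
    (hGb : ∀ z : ℂ, 0 < z.re → ∫ u in Ioi (0 : ℝ), (b u : ℂ) * Complex.exp (-z * u) = G z)
    {k : ℝ → ℂ} (hk : Continuous k) (hks : HasCompactSupport k) (hki : Integrable (𝓕 k)) :
    Tendsto (fun y : ℝ ↦ ∫ u in Ioi (0 : ℝ), (b u : ℂ) * 𝓕 k (u - y)) atTop (𝓝 0) := by
  have hkint : Integrable k := hk.integrable_of_hasCompactSupport hks
  let g : ℝ → ℝ → ℂ := fun y t ↦ Complex.exp (2 * Real.pi * t * y * Complex.I) * k t
  have hgc (y : ℝ) : Continuous (g y) := by fun_prop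
  have hgn (y t : ℝ) : ‖g y t‖ = ‖k t‖ := by
    have : (2 * Real.pi * t * y * Complex.I : ℂ) = ((2 * Real.pi * t * y : ℝ) : ℂ) * Complex.I := by
      push_cast; ring
    simp only [g, norm_mul]
    rw [this, Complex.norm_exp_ofReal_mul_I, one_mul]
  have hgint (y : ℝ) : Integrable (g y) :=
    hkint.mono (hgc y).aestronglyMeasurable (Eventually.of_forall fun t ↦ (hgn y t).le)
  have hgF (y u : ℝ) : 𝓕 (g y) u = 𝓕 k (u - y) := by
    rw [Real.fourier_real_eq_integral_exp_smul, Real.fourier_real_eq_integral_exp_smul]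
    congr 1 with t
    simp only [g, smul_eq_mul, ← mul_assoc, ← Complex.exp_add]
    congr 2
    push_cast; ring
  -- Parseval's identity for the damped function `b u * exp (-δ u)`.
  have key (y δ : ℝ) (hδ : 0 < δ) :
      ∫ t : ℝ, G (δ + 2 * Real.pi * t * Complex.I) * g y t =
        ∫ u in Ioi (0 : ℝ), ((b u : ℂ) * 𝓕 k (u - y)) * Real.exp (-δ * u) := by
    let f : ℝ → ℂ := (Ioi (0 : ℝ)).indicator fun u ↦ (b u : ℂ) * Real.exp (-δ * u)
    have hf : Integrable f := by
      refine IntegrableOn.integrable_indicator ?_ measurableSet_Ioi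
      have := (exp_neg_integrableOn_Ioi 0 hδ).const_mul C
      refine this.mono' (by fun_prop) (Eventually.of_forall fun u ↦ ?_)
      rw [norm_mul, Complex.norm_real, Complex.norm_real, Real.norm_eq_abs, Real.norm_eq_abs,
        Real.abs_exp]
      exact mul_le_mul_of_nonneg_right (hbC u) (Real.exp_pos _).le
    have hfF (t : ℝ) : 𝓕 f t = G (δ + 2 * Real.pi * t * Complex.I) := by
      rw [← hGb _ (by simpa using hδ), Real.fourier_real_eq_integral_exp_smul,
        ← integral_indicator measurableSet_Ioi]
      congr 1 with u
      by_cases hu : u ∈ Ioi (0 : ℝ)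
      · simp only [f, indicator_of_mem hu, smul_eq_mul]
        rw [mul_left_comm, Complex.ofReal_exp, ← Complex.exp_add]
        congr 2
        push_cast; ring
      · simp [f, indicator_of_notMem hu]
    have := VectorFourier.integral_fourierIntegral_smul_eq_flip (L := innerₗ ℝ) (μ := volume)
      (ν := volume) Real.continuous_fourierChar (by fun_prop) hf (hgint y)
    have h2 : ∫ t, 𝓕 f t * g y t = ∫ u, f u * 𝓕 (g y) u := by
      simpa [Real.fourier_eq, VectorFourier.fourierIntegral] using! this
    simp only [hfF, hgF] at h2
    rw [h2, ← integral_indicator measurableSet_Ioi]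
    congr 1 with u
    by_cases hu : u ∈ Ioi (0 : ℝ)
    · simp only [f, indicator_of_mem hu]; ring
    · simp [f, indicator_of_notMem hu]
  -- Letting `δ → 0` on both sides.
  have lim (y : ℝ) : ∫ t : ℝ, G (2 * Real.pi * t * Complex.I) * g y t =
      ∫ u in Ioi (0 : ℝ), (b u : ℂ) * 𝓕 k (u - y) := by
    have hR : Tendsto (fun δ : ℝ ↦ ∫ u in Ioi (0 : ℝ),
        ((b u : ℂ) * 𝓕 k (u - y)) * Real.exp (-δ * u)) (𝓝[>] 0)
        (𝓝 (∫ u in Ioi (0 : ℝ), (b u : ℂ) * 𝓕 k (u - y))) := by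
      have hi : Integrable (fun u ↦ 𝓕 k (u - y)) := hki.comp_sub_right y
      refine tendsto_integral_filter_of_dominated_convergence (fun u ↦ C * ‖𝓕 k (u - y)‖) ?_ ?_
        (hi.norm.const_mul C).integrableOn ?_
      · refine Eventually.of_forall fun δ ↦ ?_
        have := hi.aestronglyMeasurable.restrict (s := Ioi (0 : ℝ))
        have h' : AEStronglyMeasurable (fun u ↦ (b u : ℂ)) (volume.restrict (Ioi (0 : ℝ))) := by
          fun_prop
        exact (h'.mul this).mul (by fun_prop)
      · filter_upwards [self_mem_nhdsWithin] with δ (hδ : 0 < δ)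
        filter_upwards [ae_restrict_mem measurableSet_Ioi] with u (hu : 0 < u)
        rw [norm_mul, norm_mul, Complex.norm_real, Complex.norm_real, Real.norm_eq_abs,
          Real.norm_eq_abs, Real.abs_exp]
        have h1 : Real.exp (-δ * u) ≤ 1 := Real.exp_le_one_iff.2 (by nlinarith)
        calc _ ≤ |b u| * ‖𝓕 k (u - y)‖ * 1 := by gcongr
          _ ≤ _ := by rw [mul_one]; gcongr; exact hbC u
      · refine Eventually.of_forall fun u ↦ ?_
        have : Tendsto (fun δ : ℝ ↦ ((b u : ℂ) * 𝓕 k (u - y)) * Real.exp (-δ * u)) (𝓝 0)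
            (𝓝 (((b u : ℂ) * 𝓕 k (u - y)) * Real.exp (-0 * u))) :=
          Continuous.tendsto (by fun_prop) 0
        simpa using this.mono_left nhdsWithin_le_nhds
    have hmaps (δ t : ℝ) (hδ : 0 ≤ δ) :
        (δ + 2 * Real.pi * t * Complex.I : ℂ) ∈ {z : ℂ | 0 ≤ z.re} := by simpa using hδ
    have hL : Tendsto (fun δ : ℝ ↦ ∫ t : ℝ, G (δ + 2 * Real.pi * t * Complex.I) * g y t) (𝓝[>] 0)
        (𝓝 (∫ t : ℝ, G (2 * Real.pi * t * Complex.I) * g y t)) := by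
      -- `G` is bounded on the compact set swept out by the supports.
      have hcomp : IsCompact ((fun p : ℝ × ℝ ↦ (p.1 + 2 * Real.pi * p.2 * Complex.I : ℂ)) ''
          (Icc 0 1 ×ˢ tsupport k)) :=
        (isCompact_Icc.prod hks).image (by fun_prop)
      obtain ⟨M, hM⟩ := hcomp.exists_bound_of_continuousOn (hG.mono (by
        rintro _ ⟨⟨δ, t⟩, ⟨hδ, -⟩, rfl⟩
        exact hmaps δ t hδ.1))
      refine tendsto_integral_filter_of_dominated_convergence (fun t ↦ M * ‖k t‖) ?_ ?_
        (hkint.norm.const_mul M) ?_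
      · filter_upwards [self_mem_nhdsWithin] with δ (hδ : 0 < δ)
        have : Continuous fun t : ℝ ↦ G (δ + 2 * Real.pi * t * Complex.I) :=
          hG.comp_continuous (by fun_prop) fun t ↦ hmaps δ t hδ.le
        exact (this.mul (hgc y)).aestronglyMeasurable
      · filter_upwards [Ioc_mem_nhdsGT (zero_lt_one (α := ℝ))] with δ hδ
        refine Eventually.of_forall fun t ↦ ?_
        rw [norm_mul, hgn]
        by_cases ht : t ∈ tsupport k
        · gcongr
          exact hM _ ⟨(δ, t), ⟨⟨hδ.1.le, hδ.2⟩, ht⟩, rfl⟩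
        · simp [image_eq_zero_of_notMem_tsupport ht]
      · refine Eventually.of_forall fun t ↦ ?_
        have hz : Tendsto (fun δ : ℝ ↦ G (δ + 2 * Real.pi * t * Complex.I)) (𝓝[>] 0)
            (𝓝 (G ((0 : ℝ) + 2 * Real.pi * t * Complex.I))) := by
          refine (hG _ (hmaps 0 t le_rfl)).tendsto.comp (tendsto_nhdsWithin_iff.2 ⟨?_, ?_⟩)
          · exact (Continuous.tendsto (f := fun δ : ℝ ↦ (δ + 2 * Real.pi * t * Complex.I : ℂ))
              (by fun_prop) 0).mono_left nhdsWithin_le_nhds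
          · filter_upwards [self_mem_nhdsWithin] with δ (hδ : 0 < δ)
            exact hmaps δ t hδ.le
        rw [Complex.ofReal_zero, zero_add] at hz
        exact hz.mul_const _
    refine tendsto_nhds_unique (hL.congr' ?_) hR
    filter_upwards [self_mem_nhdsWithin] with δ hδ
    exact key y δ hδ
  -- The limit `y → ∞` is now the Riemann–Lebesgue lemma.
  have hRL := (Real.zero_at_infty_fourier
    (fun t : ℝ ↦ G (2 * Real.pi * t * Complex.I) * k t)).comp
      (tendsto_neg_atTop_atBot.mono_right atBot_le_cocompact)
  refine hRL.congr fun y ↦ ?_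
  rw [← lim y, Function.comp_apply, Real.fourier_real_eq_integral_exp_smul]
  congr 1 with t
  simp only [g, smul_eq_mul]
  rw [mul_left_comm]
  congr 3
  push_cast; ring

/-! ### The Fejér kernel -/

/-- The tent function of height one on `[-T, T]`, for `T > 0`. -/
noncomputable def tent (T t : ℝ) : ℝ := max 0 (1 - |t| / T)

theorem continuous_tent (T : ℝ) : Continuous (tent T) := by
  unfold tent; fun_prop

theorem tent_eq_zero {T t : ℝ} (hT : 0 < T) (ht : T ≤ |t|) : tent T t = 0 :=
  max_eq_left (sub_nonpos.2 ((one_le_div hT).2 ht))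

theorem hasCompactSupport_tent {T : ℝ} (hT : 0 < T) : HasCompactSupport (tent T) := by
  refine HasCompactSupport.intro (isCompact_Icc (a := -T) (b := T)) fun t ht ↦ tent_eq_zero hT ?_
  by_contra! h
  exact ht (abs_le.1 h.le)

open MeasureTheory Set in
theorem integral_tent_mul_cos {T a : ℝ} (hT : 0 < T) (ha : a ≠ 0) :
    ∫ t : ℝ, tent T t * Real.cos (a * t) = 2 * (1 - Real.cos (a * T)) / (T * a ^ 2) := by
  have heven : ∫ t : ℝ, tent T t * Real.cos (a * t) =
      2 * ∫ t in Ioi (0 : ℝ), tent T t * Real.cos (a * t) := by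
    rw [← integral_comp_abs]
    congr 1 with t
    have h1 : Real.cos (a * |t|) = Real.cos (a * t) := by
      rw [← Real.cos_abs (a * t), abs_mul, ← Real.cos_abs (a * |t|), abs_mul, abs_abs]
    rw [h1]
    simp [tent]
  have hcut : ∫ t in Ioi (0 : ℝ), tent T t * Real.cos (a * t) =
      ∫ t in (0 : ℝ)..T, (1 - t / T) * Real.cos (a * t) := by
    rw [intervalIntegral.integral_of_le hT.le]
    rw [setIntegral_eq_of_subset_of_forall_sdiff_eq_zero measurableSet_Ioi
      (Ioc_subset_Ioi_self : Ioc 0 T ⊆ Ioi 0)]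
    · refine setIntegral_congr_fun measurableSet_Ioc fun t ht ↦ ?_
      have : t / T ≤ 1 := (div_le_one hT).2 ht.2
      simp only [tent, abs_of_pos ht.1]
      rw [max_eq_right (by linarith)]
    · intro t ht
      have ht0 : 0 < t := ht.1
      have : T ≤ |t| := by
        rw [abs_of_pos ht0]
        by_contra! h
        exact ht.2 ⟨ht0, h.le⟩
      rw [tent_eq_zero hT this, zero_mul]
  have hFTC : ∫ t in (0 : ℝ)..T, (1 - t / T) * Real.cos (a * t) =
      (1 - Real.cos (a * T)) / (T * a ^ 2) := by
    have hd (t : ℝ) : HasDerivAt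
        (fun t ↦ (1 - t / T) * (Real.sin (a * t) / a) - Real.cos (a * t) / (T * a ^ 2))
        ((1 - t / T) * Real.cos (a * t)) t := by
      have h1 : HasDerivAt (fun t : ℝ ↦ a * t) a t := by
        simpa using (hasDerivAt_id t).const_mul a
      have h2 : HasDerivAt (fun t : ℝ ↦ 1 - t / T) (-(1 / T)) t := by
        simpa using ((hasDerivAt_id t).div_const T).const_sub 1
      convert! (h2.mul (h1.sin.div_const a)).sub (h1.cos.div_const (T * a ^ 2)) using 1
      field_simp
      ring
    rw [intervalIntegral.integral_eq_sub_of_hasDerivAt (fun t _ ↦ hd t)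
      (Continuous.intervalIntegrable (by fun_prop) _ _)]
    simp [hT.ne']
    ring
  rw [heven, hcut, hFTC, mul_div_assoc]

open MeasureTheory FourierTransform in
/-- The Fourier transform of the tent function is the Fejér kernel, which is nonnegative and
integrable. -/
theorem fourier_tent {T : ℝ} (hT : 0 < T) {u : ℝ} (hu : u ≠ 0) :
    𝓕 (fun t ↦ (tent T t : ℂ)) u = (T * Real.sinc (Real.pi * T * u) ^ 2 : ℝ) := by
  have hint (f : ℝ → ℝ) (hf : Continuous f) : Integrable (fun t ↦ tent T t * f t) :=
    ((continuous_tent T).mul hf).integrable_of_hasCompactSupport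
      (hasCompactSupport_tent hT).mul_right
  set a : ℝ := 2 * Real.pi * u with ha
  have hodd : ∫ t : ℝ, tent T t * Real.sin (a * t) = 0 := by
    have := integral_neg_eq_self (fun t : ℝ ↦ tent T t * Real.sin (a * t)) volume
    have h2 : ∀ t : ℝ, tent T (-t) * Real.sin (a * -t) = -(tent T t * Real.sin (a * t)) := by
      intro t; simp [tent]
    simp only [h2, integral_neg] at this
    linarith
  have hsplit : ∀ t : ℝ, Complex.exp (↑(-2 * Real.pi * t * u) * Complex.I) • (tent T t : ℂ) =
      ((tent T t * Real.cos (a * t) : ℝ) : ℂ) -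
        ((tent T t * Real.sin (a * t) : ℝ) : ℂ) * Complex.I := by
    intro t
    have : (-2 * Real.pi * t * u) = -(a * t) := by rw [ha]; ring
    rw [this, Complex.exp_mul_I, ← Complex.ofReal_cos, ← Complex.ofReal_sin, Real.cos_neg,
      Real.sin_neg, smul_eq_mul]
    push_cast
    ring
  rw [Real.fourier_real_eq_integral_exp_smul]
  simp only [hsplit]
  rw [integral_sub (hint _ (by fun_prop)).ofReal ((hint _ (by fun_prop)).ofReal.mul_const _),
    integral_mul_const, integral_complex_ofReal, integral_complex_ofReal, hodd,
    integral_tent_mul_cos hT (by positivity)]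
  simp only [Complex.ofReal_zero, zero_mul, sub_zero]
  congr 1
  have hpi := Real.pi_ne_zero
  rw [Real.sinc_of_ne_zero (by positivity), show a * T = 2 * (Real.pi * T * u) by rw [ha]; ring,
    Real.cos_two_mul, Real.cos_sq', ha]
  field_simp
  ring

open MeasureTheory in
theorem integrable_sinc_sq : Integrable (fun v : ℝ ↦ Real.sinc v ^ 2) := by
  refine (integrable_inv_one_add_sq.const_mul 2).mono'
    (Real.continuous_sinc.pow 2).aestronglyMeasurable (Filter.Eventually.of_forall fun v ↦ ?_)
  rw [Real.norm_of_nonneg (sq_nonneg _), ← div_eq_mul_inv, le_div_iff₀ (by positivity)]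
  have h1 : Real.sinc v ^ 2 ≤ 1 := (sq_le_one_iff_abs_le_one _).2 (Real.abs_sinc_le_one v)
  have h2 : Real.sinc v ^ 2 * v ^ 2 ≤ 1 := by
    rw [← mul_pow]
    rcases eq_or_ne v 0 with rfl | hv
    · simp
    · rw [Real.sinc_of_ne_zero hv, div_mul_cancel₀ _ hv]
      exact Real.sin_sq_le_one v
  linarith

open MeasureTheory in
theorem integral_sinc_sq_pos : 0 < ∫ v : ℝ, Real.sinc v ^ 2 := by
  refine (integral_pos_iff_support_of_nonneg (fun v ↦ sq_nonneg _) integrable_sinc_sq).2 ?_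
  have : IsOpen (Function.support fun v : ℝ ↦ Real.sinc v ^ 2) :=
    (Real.continuous_sinc.pow 2).isOpen_support
  exact this.measure_pos _ ⟨0, by simp⟩

open MeasureTheory FourierTransform Filter in
theorem integrable_fourier_tent {T : ℝ} (hT : 0 < T) :
    Integrable (𝓕 (fun t ↦ (tent T t : ℂ))) := by
  have hne : Real.pi * T ≠ 0 := by positivity
  refine ((integrable_sinc_sq.comp_mul_left' hne).const_mul T).ofReal (𝕜 := ℂ).congr ?_
  filter_upwards [compl_mem_ae_iff.2 (measure_singleton (0 : ℝ))] with u hu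
  rw [fourier_tent hT hu]
  rfl

/-! ### A Tauberian theorem -/

open MeasureTheory Filter Topology Set FourierTransform in
/-- The case of `tendsto_integral_mul_fourier_of_laplace` in which `k` is the tent function of
half-width `l / π`. -/
theorem tendsto_integral_mul_sinc_sq_of_laplace {b : ℝ → ℝ} {C : ℝ} {G : ℂ → ℂ}
    (hb : Measurable b) (hbC : ∀ u, |b u| ≤ C) (hG : ContinuousOn G {z | 0 ≤ z.re})
    (hGb : ∀ z : ℂ, 0 < z.re → ∫ u in Ioi (0 : ℝ), (b u : ℂ) * Complex.exp (-z * u) = G z)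
    {l : ℝ} (hl : 0 < l) :
    Tendsto (fun y : ℝ ↦ ∫ u in Ioi (0 : ℝ), b u * Real.sinc (l * (u - y)) ^ 2) atTop (𝓝 0) := by
  set T : ℝ := l / Real.pi with hTl
  have hT : 0 < T := by positivity
  have hTpi : Real.pi * T = l := by rw [hTl]; field_simp
  have h := tendsto_integral_mul_fourier_of_laplace hb hbC hG hGb (k := fun t ↦ (tent T t : ℂ))
    (Complex.continuous_ofReal.comp (continuous_tent T))
    ((hasCompactSupport_tent hT).comp_left Complex.ofReal_zero) (integrable_fourier_tent hT)
  have e (y : ℝ) : ∫ u in Ioi (0 : ℝ), (b u : ℂ) * 𝓕 (fun t ↦ (tent T t : ℂ)) (u - y) =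
      ((T * ∫ u in Ioi (0 : ℝ), b u * Real.sinc (l * (u - y)) ^ 2 : ℝ) : ℂ) := by
    rw [← integral_const_mul, ← integral_complex_ofReal]
    refine integral_congr_ae ?_
    filter_upwards [ae_restrict_of_ae (compl_mem_ae_iff.2 (measure_singleton y))] with u hu
    rw [fourier_tent hT (sub_ne_zero.2 hu), hTpi]
    push_cast
    ring
  simp only [e] at h
  have h2 := ((Complex.continuous_re.tendsto _).comp h).const_mul T⁻¹
  simpa [Function.comp_def, hT.ne'] using h2

open MeasureTheory Filter Topology Set in
theorem tendsto_setIntegral_Ioi_sinc_sq {l : ℝ} (hl : 0 < l) :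
    Tendsto (fun y : ℝ ↦ ∫ u in Ioi (0 : ℝ), Real.sinc (l * (u - y)) ^ 2) atTop
      (𝓝 (l⁻¹ * ∫ v : ℝ, Real.sinc v ^ 2)) := by
  have hi : Integrable (fun v : ℝ ↦ Real.sinc (l * v) ^ 2) :=
    integrable_sinc_sq.comp_mul_left' hl.ne'
  have h := (aecover_Ioi (μ := volume)
    (tendsto_neg_atTop_atBot (G := ℝ))).integral_tendsto_of_countably_generated hi
  rw [Measure.integral_comp_mul_left (fun v ↦ Real.sinc v ^ 2), smul_eq_mul,
    abs_of_pos (inv_pos.2 hl)] at h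
  refine h.congr fun y ↦ ?_
  rw [← integral_indicator measurableSet_Ioi, ← integral_indicator measurableSet_Ioi,
    ← integral_sub_right_eq_self _ y]
  congr 1 with u
  by_cases hu : 0 < u <;> simp [indicator, hu]

open MeasureTheory Filter Topology Set in
/-- The averages of `B` against the Fejér kernel of any fixed scale `l`, centred at `y`, tend to
the total mass of the kernel as `y → ∞`. -/
theorem tendsto_integral_shift_mul_sinc_sq_of_laplace {B : ℝ → ℝ} {C : ℝ} {G : ℂ → ℂ}
    (hB : Measurable B) (hB0 : ∀ u ≤ 0, B u = 0) (hBn : ∀ u, 0 ≤ B u) (hBC : ∀ u, B u ≤ C)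
    (hG : ContinuousOn G {z | 0 ≤ z.re})
    (hGB : ∀ z : ℂ, 0 < z.re →
      ∫ u in Ioi (0 : ℝ), ((B u - 1 : ℝ) : ℂ) * Complex.exp (-z * u) = G z)
    {l : ℝ} (hl : 0 < l) :
    Tendsto (fun y : ℝ ↦ ∫ v : ℝ, B (y + v / l) * Real.sinc v ^ 2) atTop
      (𝓝 (∫ v : ℝ, Real.sinc v ^ 2)) := by
  have hbC (u : ℝ) : |B u - 1| ≤ C + 1 := by
    rw [abs_le]; constructor <;> linarith [hBn u, hBC u]
  have h1 := tendsto_integral_mul_sinc_sq_of_laplace (hB.sub_const 1) hbC hG hGB hl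
  have h2 := ((h1.add (tendsto_setIntegral_Ioi_sinc_sq hl)).const_mul l)
  rw [zero_add, mul_inv_cancel_left₀ hl.ne'] at h2
  refine h2.congr fun y ↦ ?_
  have hi : Integrable (fun u : ℝ ↦ Real.sinc (l * (u - y)) ^ 2) :=
    (integrable_sinc_sq.comp_mul_left' hl.ne').comp_sub_right y
  have hib : Integrable (fun u : ℝ ↦ (B u - 1) * Real.sinc (l * (u - y)) ^ 2) := by
    refine hi.bdd_mul (c := C + 1) (hB.sub_const 1).aestronglyMeasurable
      (Eventually.of_forall hbC)
  rw [← integral_add hib.integrableOn hi.integrableOn]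
  have e : ∫ u in Ioi (0 : ℝ), ((B u - 1) * Real.sinc (l * (u - y)) ^ 2 +
      Real.sinc (l * (u - y)) ^ 2) = ∫ u : ℝ, B u * Real.sinc (l * (u - y)) ^ 2 := by
    rw [← integral_indicator measurableSet_Ioi]
    congr 1 with u
    by_cases hu : 0 < u
    · simp [indicator, hu]; ring
    · simp [indicator, hu, hB0 u (not_lt.1 hu)]
  rw [e, ← integral_add_right_eq_self _ y]
  have := Measure.integral_comp_div (fun u ↦ B (u + y) * Real.sinc (l * (u + y - y)) ^ 2) l
  rw [abs_of_pos hl, smul_eq_mul] at this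
  rw [← this]
  congr 1 with v
  rw [add_comm y, add_sub_cancel_right, mul_div_cancel₀ _ hl.ne']

open MeasureTheory Filter Topology Set in
/-- A Tauberian theorem of **Wiener–Ikehara** type: if `B` is nonnegative, bounded and zero on the
negative half-line, `exp u * B u` is monotone, and the Laplace transform of `B - 1` extends
continuously to the closed right half-plane, then `B` tends to `1`. Monotonicity lets `B y` be
compared with the averages of `B` over short windows on either side of `y`. -/
theorem tendsto_one_of_laplace {B : ℝ → ℝ} {C : ℝ} {G : ℂ → ℂ}
    (hB0 : ∀ u ≤ 0, B u = 0) (hBn : ∀ u, 0 ≤ B u) (hBC : ∀ u, B u ≤ C)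
    (hmono : Monotone fun u ↦ Real.exp u * B u)
    (hG : ContinuousOn G {z | 0 ≤ z.re})
    (hGB : ∀ z : ℂ, 0 < z.re →
      ∫ u in Ioi (0 : ℝ), ((B u - 1 : ℝ) : ℂ) * Complex.exp (-z * u) = G z) :
    Tendsto B atTop (𝓝 1) := by
  have hB : Measurable B := by
    have : B = fun u ↦ Real.exp (-u) * (Real.exp u * B u) := by
      ext u; rw [← mul_assoc, ← Real.exp_add]; simp
    rw [this]
    exact (Real.measurable_exp.comp measurable_neg).mul hmono.measurable
  have hslow {u v : ℝ} (huv : u ≤ v) : B u ≤ Real.exp (v - u) * B v := by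
    have h := hmono huv
    simp only at h
    rw [Real.exp_sub, div_mul_eq_mul_div, le_div_iff₀ (Real.exp_pos u)]
    linarith
  set c : ℝ := ∫ v : ℝ, Real.sinc v ^ 2 with hc
  have hcpos : 0 < c := integral_sinc_sq_pos
  have hJ {l : ℝ} (hl : 0 < l) :=
    tendsto_integral_shift_mul_sinc_sq_of_laplace hB hB0 hBn hBC hG hGB hl
  have hint (y l : ℝ) : Integrable fun v ↦ B (y + v / l) * Real.sinc v ^ 2 :=
    integrable_sinc_sq.bdd_mul (c := C)
      (hB.comp (by fun_prop)).aestronglyMeasurable (Eventually.of_forall fun v ↦ by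
        rw [Real.norm_of_nonneg (hBn _)]; exact hBC _)
  let m : ℝ → ℝ := fun R ↦ ∫ v in Icc (-R) R, Real.sinc v ^ 2
  have hm : Tendsto m atTop (𝓝 c) :=
    (aecover_Icc (μ := volume) tendsto_neg_atTop_atBot
      tendsto_id).integral_tendsto_of_countably_generated integrable_sinc_sq
  have hexp : Tendsto (fun h : ℝ ↦ Real.exp (2 * h)) (𝓝[>] 0) (𝓝 1) := by
    have : Tendsto (fun h : ℝ ↦ Real.exp (2 * h)) (𝓝 0) (𝓝 (Real.exp (2 * 0))) :=
      Continuous.tendsto (by fun_prop) 0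
    simpa using this.mono_left nhdsWithin_le_nhds
  have hwindow {h R v : ℝ} (hh : 0 < h) (hR : 0 < R) (hv : v ∈ Icc (-R) R) :
      |v / (R / h)| ≤ h := by
    rw [abs_div, abs_of_pos (div_pos hR hh), div_le_iff₀ (div_pos hR hh),
      mul_div_cancel₀ _ hh.ne']
    exact abs_le.2 hv
  -- With scale `l = R / h` the range `|v| ≤ R` of the kernel corresponds to a window of
  -- half-width `h`. On `[y, y + 2 * h]`, `B` is at least `exp (-2 * h) * B y`.
  have hupper {h R : ℝ} (hh : 0 < h) (hR : 0 < R) (y : ℝ) :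
      B y * m R ≤ Real.exp (2 * h) * ∫ v : ℝ, B (y + h + v / (R / h)) * Real.sinc v ^ 2 := by
    rw [← integral_const_mul, ← integral_const_mul]
    refine le_trans ?_ (setIntegral_le_integral (s := Icc (-R) R) ((hint _ _).const_mul _)
      (Eventually.of_forall fun v ↦
        mul_nonneg (Real.exp_pos _).le (mul_nonneg (hBn _) (sq_nonneg _))))
    refine setIntegral_mono_on (integrable_sinc_sq.const_mul _).integrableOn
      ((hint _ _).const_mul _).integrableOn measurableSet_Icc fun v hv ↦ ?_
    rw [← mul_assoc]
    gcongr
    obtain ⟨h2, h3⟩ := abs_le.1 (hwindow hh hR hv)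
    refine (hslow (v := y + h + v / (R / h)) (by linarith)).trans ?_
    gcongr
    · exact hBn _
    · linarith
  -- On `[y - 2 * h, y]`, `B` is at most `exp (2 * h) * B y`; elsewhere it is at most `C`.
  have hlower {h R : ℝ} (hh : 0 < h) (hR : 0 < R) (y : ℝ) :
      ∫ v : ℝ, B (y - h + v / (R / h)) * Real.sinc v ^ 2 ≤
        Real.exp (2 * h) * B y * c + C * (c - m R) := by
    have hcm : c - m R = ∫ v in (Icc (-R) R)ᶜ, Real.sinc v ^ 2 := by
      rw [hc, ← integral_add_compl (measurableSet_Icc (a := -R) (b := R)) integrable_sinc_sq]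
      simp [m]
    rw [hcm, ← integral_add_compl (measurableSet_Icc (a := -R) (b := R)) (hint _ _)]
    refine add_le_add ?_ ?_
    · rw [hc, ← integral_const_mul]
      refine le_trans ?_ (setIntegral_le_integral (s := Icc (-R) R)
        (integrable_sinc_sq.const_mul _) (Eventually.of_forall fun v ↦
          mul_nonneg (mul_nonneg (Real.exp_pos _).le (hBn _)) (sq_nonneg _)))
      refine setIntegral_mono_on (hint _ _).integrableOn
        (integrable_sinc_sq.const_mul _).integrableOn measurableSet_Icc fun v hv ↦ ?_
      gcongr
      obtain ⟨h2, h3⟩ := abs_le.1 (hwindow hh hR hv)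
      refine (hslow (v := y) (by linarith)).trans ?_
      gcongr
      · exact hBn _
      · linarith
    · rw [← integral_const_mul]
      refine setIntegral_mono (hint _ _).integrableOn
        (integrable_sinc_sq.const_mul _).integrableOn fun v ↦ ?_
      exact mul_le_mul_of_nonneg_right (hBC _) (sq_nonneg _)
  refine tendsto_order.2 ⟨fun a ha ↦ ?_, fun a ha ↦ ?_⟩
  -- In each case first `h` is taken small, then `R` so large that `m R` is close enough to `c`.
  · obtain ⟨h, hha, hh⟩ : ∃ h : ℝ, Real.exp (2 * h) * a < 1 ∧ 0 < h := by
      have : Tendsto (fun h : ℝ ↦ Real.exp (2 * h) * a) (𝓝[>] 0) (𝓝 (1 * a)) := hexp.mul_const a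
      exact ((this.eventually_lt_const (by linarith)).and self_mem_nhdsWithin).exists
    obtain ⟨R, hRm, hR⟩ : ∃ R : ℝ, Real.exp (2 * h) * a * c + C * (c - m R) < c ∧ 0 < R := by
      have : Tendsto (fun R : ℝ ↦ Real.exp (2 * h) * a * c + C * (c - m R)) atTop
          (𝓝 (Real.exp (2 * h) * a * c + C * (c - c))) :=
        ((hm.const_sub c).const_mul C).const_add _
      exact ((this.eventually_lt_const (by nlinarith)).and (eventually_gt_atTop 0)).exists
    have hlim := (hJ (div_pos hR hh)).comp (tendsto_atTop_add_const_right _ (-h) tendsto_id)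
    filter_upwards [hlim.eventually_const_lt hRm] with y hy
    have h1 := hy.trans_le (hlower hh hR y)
    have h2 : Real.exp (2 * h) * a * c < Real.exp (2 * h) * B y * c := by linarith
    exact lt_of_mul_lt_mul_left (lt_of_mul_lt_mul_right h2 hcpos.le) (Real.exp_pos _).le
  · obtain ⟨h, hha, hh⟩ : ∃ h : ℝ, Real.exp (2 * h) < a ∧ 0 < h :=
      ((hexp.eventually_lt_const ha).and self_mem_nhdsWithin).exists
    obtain ⟨R, ⟨hRm, hmR⟩, hR⟩ : ∃ R : ℝ, (Real.exp (2 * h) * c < a * m R ∧ 0 < m R) ∧ 0 < R := by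
      have : Tendsto (fun R : ℝ ↦ a * m R) atTop (𝓝 (a * c)) := hm.const_mul a
      exact (((this.eventually_const_lt (by gcongr)).and (hm.eventually_const_lt hcpos)).and
        (eventually_gt_atTop 0)).exists
    have hlim := ((hJ (div_pos hR hh)).comp
      (tendsto_atTop_add_const_right _ h tendsto_id)).const_mul (Real.exp (2 * h))
    filter_upwards [hlim.eventually_lt_const hRm] with y hy
    exact lt_of_mul_lt_mul_right ((hupper hh hR y).trans_lt hy) hmR.le

/-! ### Convergence of `ψ x / x` -/

/-- `-ζ'/ζ` is continuous on the closed half-plane `1 ≤ re s` up to a simple pole with residue `1`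
at `s = 1`. This contains the nonvanishing of `ζ` on the line `re s = 1`; it is read off from the
result for residue classes by taking the modulus `1`. -/
theorem exists_continuousOn_LSeries_vonMangoldt_sub_inv :
    ∃ F : ℂ → ℂ, ContinuousOn F {s | 1 ≤ s.re} ∧ ∀ s : ℂ, 1 < s.re →
      LSeries (fun n ↦ (ArithmeticFunction.vonMangoldt n : ℂ)) s = F s + 1 / (s - 1) := by
  refine ⟨_, ArithmeticFunction.vonMangoldt.continuousOn_LFunctionResidueClassAux (q := 1) 0,
    fun s hs ↦ ?_⟩
  have h := ArithmeticFunction.vonMangoldt.eqOn_LFunctionResidueClassAux (q := 1) (a := 0)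
    (isUnit_of_subsingleton _) (Set.mem_ofPred.2 hs)
  have hL : LSeries (fun n ↦ (ArithmeticFunction.vonMangoldt n : ℂ)) s =
      LSeries (fun n ↦ (ArithmeticFunction.vonMangoldt.residueClass (0 : ZMod 1) n : ℂ)) s := by
    refine LSeries_congr (fun {n} _ ↦ ?_) s
    simp [ArithmeticFunction.vonMangoldt.residueClass, Subsingleton.elim _ (0 : ZMod 1)]
  rw [h, hL]
  simp

open Chebyshev Asymptotics Filter MeasureTheory Set in
theorem LSeries_vonMangoldt_eq_mul_integral_psi {s : ℂ} (hs : 1 < s.re) :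
    LSeries (fun n ↦ (ArithmeticFunction.vonMangoldt n : ℂ)) s =
      s * ∫ t in Ioi (1 : ℝ), (psi t : ℂ) * (t : ℂ) ^ (-(s + 1)) := by
  have hsum (t : ℝ) : ∑ k ∈ Finset.Icc 1 ⌊t⌋₊, ArithmeticFunction.vonMangoldt k = psi t := by
    rw [psi, ← Finset.Icc_add_one_left_eq_Ioc, zero_add]
  rw [LSeries_eq_mul_integral_of_nonneg _ zero_le_one hs ?_
    fun n ↦ ArithmeticFunction.vonMangoldt_nonneg]
  · simp_rw [← hsum]
    push_cast
    rfl
  · refine IsBigO.of_bound (Real.log 4 + 4) (Eventually.of_forall fun n ↦ ?_)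
    have := hsum n
    rw [Nat.floor_natCast] at this
    rw [this, Real.rpow_one, Real.norm_of_nonneg (psi_nonneg _),
      Real.norm_of_nonneg (Nat.cast_nonneg n)]
    exact psi_le_const_mul_self (Nat.cast_nonneg n)

open Chebyshev MeasureTheory Set in
/-- The substitution `t = exp u` turns the Mellin transform of `ψ` at `s = 1 + z` into the Laplace
transform of `exp (-u) * ψ (exp u)` at `z`. -/
theorem integral_psi_mul_cpow_eq_laplace (z : ℂ) :
    ∫ t in Ioi (1 : ℝ), (psi t : ℂ) * (t : ℂ) ^ (-(1 + z + 1)) =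
      ∫ u in Ioi (0 : ℝ), ((Real.exp (-u) * psi (Real.exp u) : ℝ) : ℂ) * Complex.exp (-z * u) := by
  have himg : Real.exp '' Ioi 0 = Ioi 1 := by
    ext t
    constructor
    · rintro ⟨u, hu, rfl⟩
      exact Real.one_lt_exp_iff.2 hu
    · intro ht
      exact ⟨Real.log t, Real.log_pos ht, Real.exp_log (zero_lt_one.trans ht)⟩
  rw [← himg, integral_image_eq_integral_abs_deriv_smul measurableSet_Ioi
    (fun u _ ↦ (Real.hasDerivAt_exp u).hasDerivWithinAt) Real.exp_injective.injOn]
  refine setIntegral_congr_fun measurableSet_Ioi fun u _ ↦ ?_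
  simp only [Real.abs_exp, Complex.real_smul]
  rw [Complex.cpow_def_of_ne_zero (by exact_mod_cast (Real.exp_pos u).ne'), ← Complex.ofReal_log
    (Real.exp_pos u).le, Real.log_exp]
  push_cast
  have : Complex.exp (-u) * Complex.exp (-z * u) =
      Complex.exp u * Complex.exp (u * -(1 + z + 1)) := by
    rw [← Complex.exp_add, ← Complex.exp_add]
    congr 1
    ring
  linear_combination (-psi (Real.exp u) : ℂ) * this

open Chebyshev Filter Topology MeasureTheory Set in
/-- The prime number theorem in the form `ψ x ~ x`. -/
theorem tendsto_psi_div_self : Tendsto (fun x ↦ psi x / x) atTop (𝓝 1) := by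
  obtain ⟨F, hF, hFL⟩ := exists_continuousOn_LSeries_vonMangoldt_sub_inv
  let B : ℝ → ℝ := fun u ↦ Real.exp (-u) * psi (Real.exp u)
  have hBn (u : ℝ) : 0 ≤ B u := mul_nonneg (Real.exp_pos _).le (psi_nonneg _)
  have hBC (u : ℝ) : B u ≤ Real.log 4 + 4 := by
    have h := mul_le_mul_of_nonneg_left (psi_le_const_mul_self (Real.exp_pos u).le)
      (Real.exp_pos (-u)).le
    rwa [mul_left_comm, ← Real.exp_add, neg_add_cancel, Real.exp_zero, mul_one] at h
  have hmono : Monotone fun u ↦ Real.exp u * B u := by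
    have e : (fun u ↦ Real.exp u * B u) = fun u ↦ psi (Real.exp u) := by
      ext u
      simp only [B]
      rw [← mul_assoc, ← Real.exp_add, add_neg_cancel, Real.exp_zero, one_mul]
    rw [e]
    exact psi_mono.comp Real.exp_monotone
  have hBm : Measurable B := by
    have := (psi_mono.comp Real.exp_monotone).measurable
    exact (Real.measurable_exp.comp measurable_neg).mul this
  have hne {z : ℂ} (hz : 0 ≤ z.re) : 1 + z ≠ 0 := fun h ↦ by
    have := congrArg Complex.re h
    simp at this
    linarith
  have hB : Tendsto B atTop (𝓝 1) := by
    -- The Laplace transform of `B - 1` is `(F (1 + z) + 1 / z) / (1 + z) - 1 / z`, in which the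
    -- pole at `z = 0` cancels.
    refine tendsto_one_of_laplace (G := fun z ↦ (F (1 + z) - 1) / (1 + z)) (fun u hu ↦ ?_) hBn hBC
      hmono ?_ fun z hz ↦ ?_
    · simp only [B]
      rw [psi_eq_zero_of_le_one (Real.exp_le_one_iff.2 hu), mul_zero]
    · refine ContinuousOn.div ((hF.comp (by fun_prop) fun z hz ↦ ?_).sub continuousOn_const)
        (by fun_prop) fun z hz ↦ hne hz
      simpa using! hz
    · have hz0 : z ≠ 0 := fun h ↦ by simp [h] at hz
      have hexp : IntegrableOn (fun u : ℝ ↦ Complex.exp (-z * u)) (Ioi 0) :=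
        integrableOn_exp_mul_complex_Ioi (by simpa using hz) 0
      have hBexp : IntegrableOn (fun u : ℝ ↦ (B u : ℂ) * Complex.exp (-z * u)) (Ioi 0) := by
        refine Integrable.bdd_mul (c := Real.log 4 + 4) hexp
          (Complex.measurable_ofReal.comp hBm).aestronglyMeasurable
          (Eventually.of_forall fun u ↦ ?_)
        rw [Complex.norm_real, Real.norm_of_nonneg (hBn u)]
        exact hBC u
      have h1 : ∫ u in Ioi (0 : ℝ), Complex.exp (-z * u) = 1 / z := by
        rw [integral_exp_mul_complex_Ioi (by simpa using hz)]
        simp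
      have hs : 1 < (1 + z).re := by simpa using hz
      have h2 : ∫ u in Ioi (0 : ℝ), (B u : ℂ) * Complex.exp (-z * u) =
          (F (1 + z) + 1 / z) / (1 + z) := by
        have := hFL _ hs
        rw [LSeries_vonMangoldt_eq_mul_integral_psi hs, integral_psi_mul_cpow_eq_laplace,
          add_sub_cancel_left] at this
        rw [← this, mul_div_cancel_left₀ _ (hne hz.le)]
      have hsub : ∀ u : ℝ, ((B u - 1 : ℝ) : ℂ) * Complex.exp (-z * u) =
          (B u : ℂ) * Complex.exp (-z * u) - Complex.exp (-z * u) := fun u ↦ by push_cast; ring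
      simp only [hsub]
      rw [integral_sub hBexp hexp, h1, h2]
      have := hne hz.le
      field_simp
      ring
  refine (hB.comp Real.tendsto_log_atTop).congr' ?_
  filter_upwards [eventually_gt_atTop 0] with x hx
  simp only [Function.comp_apply, B, Real.exp_neg, Real.exp_log hx]
  ring

theorem mainTheorem3 :
    ModifiedLambdaMeanValueOne ∧ (ModifiedLambdaMeanValueOne ↔ PrimeNumberTheorem) :=
  ⟨modifiedLambdaMeanValueOne_iff_tendsto_psi_div.2 tendsto_psi_div_self,
    modifiedLambdaMeanValueOne_iff_tendsto_psi_div.trans <|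
      tendsto_theta_div_iff_tendsto_psi_div.symm.trans
        primeNumberTheorem_iff_tendsto_theta_div.symm⟩
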